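/- For a diffeological space $X$ and $x\in X$, let $\mathcal G(X,x)$ be the $\mathbb{R}$-algebra of germs at $x$ (with respect to the $D$-topology, the finest topology making all plots continuous) of smooth real-valued functions. The right tangent space $\hat T^R_x(X)$ is the vector space of $\mathbb{R}$-linear maps $D\colon\mathcal G(X,x)\to\mathbb{R}$ with $D(gh)=g(x)D(h)+h(x)D(g)$ for all $g,h\in\mathcal G(X,x)$. A germ at $y$ of a basepoint-preserving smooth map $f\colon(Y,y)\to(X,x)$ induces the linear map $\hat T^R(f)\colon\hat T^R_y(Y)\to\hat T^R_x(X)$, $(\hat T^R(f)D)(g)=D(g\circ f)$. The $(Y,y)$-right tangent space of $X$ at $x$ is the linear subspace $$\hat T^{(Y,y)}_x(X)=\bigl\langle\, \hat T^R(f)D \;\big|\; f\colon(Y,y)\to(X,x)\text{ a germ of a basepoint-preserving smooth map},\ D\in\hat T^R_y(Y)\,\bigr\rangle_{\mathbb{R}}\subset \hat T^R_x(X).$$ For $k\ge 1$ let $H_k=\mathbb{R}^k/O(k)$ with the quotient diffeology, and let $0\in H_k$ be the class of the origin. Theorem. Let $n,m\ge 1$ be integers. Then $$\hat T^{(H_m,0)}_0(H_n)\cong\begin{cases}\mathbb{R},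 & \text{if } m\le n,\\ 0, & \text{if } m>n.\end{cases}$$ -/

import Mathlib

noncomputable section

open Diffeology Filter Topology
open scoped ContDiff

namespace DiffTangent

section Bump

/-- Inside any neighbourhood of `t` there is a smooth map of `ℝⁿ` that is the identity near `t`.
Precomposition with it turns a plot defined near `t` into a plot defined on all of `ℝⁿ`. -/
lemma exists_smooth_retract {n : ℕ} {u : Set (EuclideanSpace ℝ (Fin n))} (hu : IsOpen u)
    {t : EuclideanSpace ℝ (Fin n)} (ht : t ∈ u) :
    ∃ g : EuclideanSpace ℝ (Fin n) → EuclideanSpace ℝ (Fin n),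
      ContDiff ℝ ∞ g ∧ (∀ s, g s ∈ u) ∧ ∀ᶠ s in 𝓝 t, g s = s := by
  obtain ⟨ε, hε, hball⟩ := Metric.isOpen_iff.1 hu t ht
  let φ : ContDiffBump t := ⟨ε / 2, ε, by positivity, by linarith⟩
  refine ⟨fun s => t + φ s • (s - t), ?_, fun s => hball ?_, ?_⟩
  · exact contDiff_const.add (φ.contDiff.smul (contDiff_id.sub contDiff_const))
  · by_cases hs : φ s = 0
    · simpa [hs] using hε
    · have hs' : s ∈ Metric.ball t ε := by
        have : s ∈ Function.support φ := hs
        rwa [φ.support_eq] at this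
      rw [Metric.mem_ball, dist_eq_norm] at hs' ⊢
      rw [add_sub_cancel_left, norm_smul, Real.norm_of_nonneg φ.nonneg]
      exact lt_of_le_of_lt (mul_le_of_le_one_left (norm_nonneg _) φ.le_one) hs'
  · filter_upwards [φ.eventuallyEq_one] with s hs
    simp [hs]

end Bump

section Quotient

/-- The quotient diffeology: a map `p` is a plot iff locally it is the composite of the
projection with a plot of the total space. -/
instance quotientDiffeology {X : Type*} [DiffeologicalSpace X] (s : Setoid X) :
    DiffeologicalSpace (Quotient s) where
  plots n := {p | ∀ t, ∃ q : EuclideanSpace ℝ (Fin n) → X,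
    IsPlot q ∧ ∀ᶠ r in 𝓝 t, p r = Quotient.mk s (q r)}
  constant_plots x := fun _ => by
    obtain ⟨y, rfl⟩ := Quotient.exists_rep x
    exact ⟨fun _ => y, isPlot_const, Eventually.of_forall fun _ => rfl⟩
  plot_reparam {n m p f} hp hf := fun t => by
    obtain ⟨q, hq, hpq⟩ := hp (f t)
    exact ⟨q ∘ f, isPlot_reparam hq hf, hf.continuous.continuousAt.eventually hpq⟩
  locality {n p} hp := fun t => by
    obtain ⟨u, hu, htu, h⟩ := hp t
    obtain ⟨g, hg, hgu, hgt⟩ := exists_smooth_retract hu htu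
    obtain ⟨q, hq, hpq⟩ := h hgu hg t
    refine ⟨q, hq, ?_⟩
    filter_upwards [hpq, hgt] with r h₁ h₂
    rw [← h₁, Function.comp_apply, h₂]

end Quotient

section Germs

variable {X Y Z : Type*} [DiffeologicalSpace X] [DiffeologicalSpace Y] [DiffeologicalSpace Z]

/-- The neighbourhood filter of a point for the D-topology. -/
def dNhds (x : X) : Filter X := @nhds X dTopology x

/-- `f` restricts to a smooth map on the subset `u`, where `u` carries the subset diffeology (its
plots are the plots of `X` with values in `u`). -/
def DSmoothOn (f : X → Y) (u : Set X) : Prop :=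
  ∀ (n : ℕ) (p : EuclideanSpace ℝ (Fin n) → X), IsPlot p → (∀ t, p t ∈ u) → IsPlot (f ∘ p)

/-- `f` restricts to a smooth map on some D-open neighbourhood of `x`. The values of `f` away from
`x` are irrelevant. -/
def SmoothNear (f : X → Y) (x : X) : Prop :=
  ∃ u : Set X, IsOpen[dTopology] u ∧ x ∈ u ∧ DSmoothOn f u

lemma DSmoothOn.mono {f : X → Y} {u v : Set X} (hf : DSmoothOn f u) (h : v ⊆ u) :
    DSmoothOn f v :=
  fun n p hp hpv => hf n p hp fun t => h (hpv t)

lemma DSmoothOn.isOpen_inter_preimage {f : X → Y} {u : Set X} {v : Set Y}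
    (hf : DSmoothOn f u) (hu : IsOpen[dTopology] u)
    (hv : IsOpen[dTopology] v) :
    IsOpen[dTopology] (u ∩ f ⁻¹' v) := by
  rw [isOpen_iff_preimages_plots] at hu hv ⊢
  intro n p hp
  rw [isOpen_iff_mem_nhds]
  rintro t ⟨htu, htv⟩
  obtain ⟨g, hg, hgu, hgt⟩ := exists_smooth_retract (hu n p hp) htu
  have hpl : IsPlot (f ∘ (p ∘ g)) := hf n _ (isPlot_reparam hp hg) hgu
  have hmem : (f ∘ (p ∘ g)) ⁻¹' v ∈ 𝓝 t := by
    refine (hv n _ hpl).mem_nhds ?_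
    simpa [hgt.self_of_nhds] using htv
  filter_upwards [hmem, hgt, (hu n p hp).mem_nhds htu] with s h₁ h₂ h₃
  refine ⟨h₃, ?_⟩
  simpa [h₂] using h₁

lemma SmoothNear.tendsto {f : X → Y} {x : X} {y : Y} (hf : SmoothNear f x) (hxy : f x = y) :
    Tendsto f (dNhds x) (dNhds y) := by
  obtain ⟨u, hu, hxu, hfu⟩ := hf
  intro s hs
  obtain ⟨v, hvs, hv, hyv⟩ := (@mem_nhds_iff Y dTopology y s).1 hs
  refine (@mem_nhds_iff X dTopology x _).2
    ⟨u ∩ f ⁻¹' v, fun z hz => hvs hz.2, hfu.isOpen_inter_preimage hu hv, hxu, ?_⟩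
  simpa [hxy] using hyv

lemma SmoothNear.comp {g : Y → Z} {f : X → Y} {x : X} {y : Y} (hg : SmoothNear g y)
    (hf : SmoothNear f x) (hxy : f x = y) : SmoothNear (g ∘ f) x := by
  obtain ⟨u, hu, hxu, hfu⟩ := hf
  obtain ⟨v, hv, hyv, hgv⟩ := hg
  refine ⟨u ∩ f ⁻¹' v, hfu.isOpen_inter_preimage hu hv, ⟨hxu, by simpa [hxy] using hyv⟩, ?_⟩
  exact fun n p hp hpu => hgv n _ (hfu n p hp fun t => (hpu t).1) fun t => (hpu t).2

lemma SmoothNear.const (x : X) (y : Y) : SmoothNear (fun _ : X => y) x :=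
  ⟨Set.univ, @isOpen_univ X dTopology, Set.mem_univ x,
    fun _ _ _ _ => isPlot_const⟩

lemma SmoothNear.add {f g : X → ℝ} {x : X} (hf : SmoothNear f x) (hg : SmoothNear g x) :
    SmoothNear (f + g) x := by
  obtain ⟨u, hu, hxu, hfu⟩ := hf
  obtain ⟨v, hv, hxv, hgv⟩ := hg
  refine ⟨u ∩ v, @IsOpen.inter X dTopology u v hu hv, ⟨hxu, hxv⟩,
    fun n p hp h => ?_⟩
  exact ((hfu n p hp fun t => (h t).1).contDiff.add (hgv n p hp fun t => (h t).2).contDiff).isPlot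

lemma SmoothNear.mul {f g : X → ℝ} {x : X} (hf : SmoothNear f x) (hg : SmoothNear g x) :
    SmoothNear (f * g) x := by
  obtain ⟨u, hu, hxu, hfu⟩ := hf
  obtain ⟨v, hv, hxv, hgv⟩ := hg
  refine ⟨u ∩ v, @IsOpen.inter X dTopology u v hu hv, ⟨hxu, hxv⟩,
    fun n p hp h => ?_⟩
  exact ((hfu n p hp fun t => (h t).1).contDiff.mul (hgv n p hp fun t => (h t).2).contDiff).isPlot

/-- The real functions that are smooth near `x`. -/
def smoothNearAlg (x : X) : Subalgebra ℝ (X → ℝ) where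
  carrier := {f | SmoothNear f x}
  add_mem' := SmoothNear.add
  mul_mem' := SmoothNear.mul
  algebraMap_mem' c := SmoothNear.const x c

/-- The ideal of the functions that vanish on a D-neighbourhood of `x`. -/
def nearZeroIdeal (x : X) : Ideal (smoothNearAlg x) where
  carrier := {f | ∀ᶠ z in dNhds x, (f : X → ℝ) z = 0}
  zero_mem' := Eventually.of_forall fun _ => rfl
  add_mem' {f g} hf hg := by
    filter_upwards [hf, hg] with z h₁ h₂
    simp [h₁, h₂]
  smul_mem' f g hg := by
    filter_upwards [hg] with z h
    simp [h]

/-- The `ℝ`-algebra of germs at `x` of smooth real functions: two functions smooth near `x` have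
the same germ iff they agree on a D-neighbourhood of `x`. -/
abbrev SmoothGerm (x : X) : Type _ := smoothNearAlg x ⧸ nearZeroIdeal x

/-- The value at `x` of a germ at `x`. -/
def evalGerm (x : X) : SmoothGerm x →ₐ[ℝ] ℝ :=
  Ideal.Quotient.liftₐ (nearZeroIdeal x)
    ((Pi.evalAlgHom ℝ (fun _ : X => ℝ) x).comp (smoothNearAlg x).val)
    fun _ hf => @Eventually.self_of_nhds X dTopology x _ hf

end Germs

section RightTangent

variable {X Y : Type*} [DiffeologicalSpace X] [DiffeologicalSpace Y]

/-- The right tangent space of `X` at `x`: the linear maps `D` from germs at `x` to `ℝ` with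
`D (g * h) = g(x) D h + h(x) D g`. -/
def RightTangent (x : X) : Submodule ℝ (SmoothGerm x →ₗ[ℝ] ℝ) where
  carrier := {D | ∀ g h : SmoothGerm x, D (g * h) = evalGerm x g * D h + evalGerm x h * D g}
  zero_mem' := fun _ _ => by simp
  add_mem' {D E} hD hE := fun g h => by
    simp only [LinearMap.add_apply, hD g h, hE g h]
    ring
  smul_mem' c D hD := fun g h => by
    simp only [LinearMap.smul_apply, smul_eq_mul, hD g h]
    ring

/-- The based maps `(Y, y) → (X, x)` that are smooth near `y`. -/
def LocalMap (y : Y) (x : X) : Type _ := {f : Y → X // SmoothNear f y ∧ f y = x}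

/-- Equality on a D-neighbourhood of the base point. -/
instance localMapSetoid (y : Y) (x : X) : Setoid (LocalMap y x) where
  r f g := ∀ᶠ z in dNhds y, f.1 z = g.1 z
  iseqv :=
    { refl := fun _ => Eventually.of_forall fun _ => rfl
      symm := fun h => h.mono fun _ => Eq.symm
      trans := fun h₁ h₂ => by
        filter_upwards [h₁, h₂] with z e₁ e₂
        exact e₁.trans e₂ }

/-- The morphisms `(Y, y) → (X, x)`: germs of smooth maps that preserve the base point. -/
def GermHom (y : Y) (x : X) : Type _ := Quotient (localMapSetoid y x)

/-- Composition with `f` on functions that are smooth near `x = f y`. -/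
def LocalMap.comapAlg {y : Y} {x : X} (f : LocalMap y x) :
    smoothNearAlg x →ₐ[ℝ] smoothNearAlg y where
  toFun φ := ⟨φ.1 ∘ f.1, SmoothNear.comp φ.2 f.2.1 f.2.2⟩
  map_one' := rfl
  map_mul' _ _ := rfl
  map_zero' := rfl
  map_add' _ _ := rfl
  commutes' _ := rfl

/-- Composition with `f` on germs. -/
def LocalMap.pullback {y : Y} {x : X} (f : LocalMap y x) : SmoothGerm x →ₐ[ℝ] SmoothGerm y :=
  Ideal.quotientMapₐ (nearZeroIdeal y) f.comapAlg
    fun _ hφ => (f.2.1.tendsto f.2.2).eventually hφ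

lemma LocalMap.pullback_congr {y : Y} {x : X} {f g : LocalMap y x}
    (h : ∀ᶠ z in dNhds y, f.1 z = g.1 z) : f.pullback = g.pullback := by
  refine AlgHom.ext fun a => ?_
  obtain ⟨φ, rfl⟩ := Ideal.Quotient.mk_surjective a
  refine Ideal.Quotient.eq.2 ?_
  change ∀ᶠ z in dNhds y, φ.1 (f.1 z) - φ.1 (g.1 z) = 0
  filter_upwards [h] with z hz
  rw [hz, sub_self]

/-- Composition with a morphism, as a map on germs. -/
def GermHom.pullback {y : Y} {x : X} (f : GermHom y x) : SmoothGerm x →ₐ[ℝ] SmoothGerm y :=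
  Quotient.lift LocalMap.pullback (fun _ _ h => LocalMap.pullback_congr h) f

lemma GermHom.evalGerm_pullback {y : Y} {x : X} (f : GermHom y x) (a : SmoothGerm x) :
    evalGerm y (f.pullback a) = evalGerm x a := by
  obtain ⟨f, rfl⟩ := Quotient.exists_rep f
  obtain ⟨φ, rfl⟩ := Ideal.Quotient.mk_surjective a
  change φ.1 (f.1 y) = φ.1 x
  rw [f.2.2]

/-- The linear map of right tangent spaces induced by a morphism `f`, `D ↦ (g ↦ D (g ∘ f))`. -/
def GermHom.rightMap {y : Y} {x : X} (f : GermHom y x) : RightTangent y →ₗ[ℝ] RightTangent x where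
  toFun D := ⟨D.1 ∘ₗ f.pullback.toLinearMap, fun g h => by
    simp [D.2 (f.pullback g) (f.pullback h), f.evalGerm_pullback]⟩
  map_add' _ _ := rfl
  map_smul' _ _ := rfl

/-- The `(Y, y)`-right tangent space of `X` at `x`: the span in the right tangent space of `X` at
`x` of the images of right tangent vectors of `Y` at `y` under all morphisms
`(Y, y) → (X, x)`. -/
def TestRightTangent (y : Y) (x : X) : Submodule ℝ (RightTangent x) :=
  Submodule.span ℝ {E | ∃ (f : GermHom y x) (D : RightTangent y), E = f.rightMap D}

end RightTangent

section OrbitSpace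

/-- Lying in the same orbit of `O(k)`, the group of linear isometries of Euclidean `ℝᵏ`. -/
def orthogonalSetoid (k : ℕ) : Setoid (EuclideanSpace ℝ (Fin k)) where
  r v w := ∃ A : EuclideanSpace ℝ (Fin k) ≃ₗᵢ[ℝ] EuclideanSpace ℝ (Fin k), A v = w
  iseqv :=
    { refl := fun _ => ⟨LinearIsometryEquiv.refl ℝ _, rfl⟩
      symm := fun ⟨A, h⟩ => ⟨A.symm, by rw [← h, A.symm_apply_apply]⟩
      trans := fun ⟨A, h⟩ ⟨B, h'⟩ => ⟨A.trans B, by rw [← h', ← h]; rfl⟩ }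

/-- The orbit space `H_k = ℝᵏ / O(k)`; as a quotient it carries the quotient diffeology. -/
abbrev OrbitSpace (k : ℕ) : Type := Quotient (orthogonalSetoid k)

/-- The class of the origin. -/
def origin (k : ℕ) : OrbitSpace k := Quotient.mk (orthogonalSetoid k) 0

end OrbitSpace

end DiffTangent

end

/-! Germs at the origin of `H_k` are germs of smooth radial functions on `ℝᵏ`. The radial Hadamard
lemma `IsRadial.exists_eq_add_norm_sq_mul` writes such a function as `f 0 + ‖x‖² h` with `h` smooth
and radial, so the ideal of germs vanishing at the origin is generated by `s_k = ‖x‖²`. A derivation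
is therefore determined by its value on `s_k`, and `exists_derivation_of_principal` shows that the
value `1` occurs: the right tangent space is a line.

The subspace is thus zero or everything, depending on whether some `D (f^* s_n)` is nonzero. Since
`f^* s_n = s_m b`, this number is `b(0) D(s_m)`. If `m ≤ n`, an isometric embedding gives `b = 1`.
If `m > n`, a local lift `q` of `f` satisfies `‖q x‖² = ‖x‖² b(x)`; along a kernel vector of `dq(0)`
the left side is `o(t²)`, so `b(0) = 0` (`eq_zero_of_norm_sq_eq_norm_sq_mul`). -/

noncomputable section

open Diffeology Filter Topology
open scoped ContDiff

/-! ### Smooth dependence of integrals on a parameter -/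

section ParametricIntegral

open MeasureTheory

variable {E : Type} [NormedAddCommGroup E] [NormedSpace ℝ E]

/-- Differentiation under the integral sign replaces `F` by `E →L[ℝ] F`, so the induction must
quantify over the target space. -/
lemma contDiff_nat_parametric_intervalIntegral [FiniteDimensional ℝ E] (k : ℕ) :
    ∀ {F : Type} [NormedAddCommGroup F] [NormedSpace ℝ F] {G : E → ℝ → F} (a b : ℝ),
      ContDiff ℝ ∞ (Function.uncurry G) → ContDiff ℝ k (fun x => ∫ t in a..b, G x t) := by
  induction k with
  | zero =>
    intro F _ _ G a b hG
    exact contDiff_zero.2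
      (intervalIntegral.continuous_parametric_intervalIntegral_of_continuous' hG.continuous a b)
  | succ k ih =>
    intro F _ _ G a b hG
    have hslice (t : ℝ) : ContDiff ℝ ∞ fun x => G x t :=
      hG.comp (contDiff_id.prodMk contDiff_const)
    let G' : E → ℝ → E →L[ℝ] F := fun x t => fderiv ℝ (fun z => G z t) x
    have hG' : ContDiff ℝ ∞ (Function.uncurry G') := by
      refine ContDiff.fderiv (f := fun (p : E × ℝ) z => G z p.2) (m := ∞) (n := ∞) ?_ contDiff_fst
        (by simp)
      exact hG.comp (contDiff_snd.prodMk (contDiff_snd.comp contDiff_fst))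
    refine contDiff_succ_iff_hasFDerivAt.2 ⟨fun x => ∫ t in a..b, G' x t, ih a b hG', fun x => ?_⟩
    have : ProperSpace E := FiniteDimensional.proper ℝ E
    obtain ⟨C, hC⟩ := ((isCompact_closedBall x 1).prod
      (isCompact_uIcc (a := a) (b := b))).exists_bound_of_continuousOn hG'.continuous.continuousOn
    have hcont (z : E) : Continuous (G z) :=
      hG.continuous.comp (continuous_const.prodMk continuous_id)
    refine intervalIntegral.hasFDerivAt_integral_of_dominated_of_fderiv_le (bound := fun _ => C)
      (Metric.closedBall_mem_nhds x one_pos)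
      (Eventually.of_forall fun z => (hcont z).aestronglyMeasurable)
      ((hcont x).intervalIntegrable a b) ?_ ?_ (by simp) ?_
    · exact (hG'.continuous.comp (continuous_const.prodMk continuous_id)).aestronglyMeasurable
    · exact Eventually.of_forall fun t ht z hz =>
        hC (z, t) ⟨hz, Set.uIoc_subset_uIcc ht⟩
    · exact Eventually.of_forall fun t _ z _ =>
        ((hslice t).differentiable (by simp) z).hasFDerivAt

/-- The integral over a compact interval of a smooth function depends smoothly on a parameter. -/
lemma contDiff_parametric_intervalIntegral [FiniteDimensional ℝ E] {F : Type}
    [NormedAddCommGroup F] [NormedSpace ℝ F] {G : E → ℝ → F} (a b : ℝ)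
    (hG : ContDiff ℝ ∞ (Function.uncurry G)) : ContDiff ℝ ∞ (fun x => ∫ t in a..b, G x t) :=
  contDiff_infty.2 fun k => contDiff_nat_parametric_intervalIntegral k a b hG

lemma ContDiff.add_sub_eq_integral_fderiv {f : E → ℝ} (hf : ContDiff ℝ ∞ f) (x y : E) :
    f (x + y) - f x = ∫ t in (0 : ℝ)..1, fderiv ℝ f (x + t • y) y := by
  have hd (t : ℝ) : HasDerivAt (fun t : ℝ => f (x + t • y)) (fderiv ℝ f (x + t • y) y) t := by
    have h1 : HasDerivAt (fun t : ℝ => x + t • y) y t := by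
      simpa using ((hasDerivAt_id t).smul_const y).const_add x
    exact ((hf.differentiable (by simp) _).hasFDerivAt).comp_hasDerivAt t h1
  have hc : Continuous fun t : ℝ => fderiv ℝ f (x + t • y) y := by
    have := hf.continuous_fderiv (by simp)
    fun_prop
  rw [intervalIntegral.integral_eq_sub_of_hasDerivAt (fun t _ => hd t)
    (hc.intervalIntegrable 0 1)]
  simp

end ParametricIntegral

/-! ### Radial functions and Hadamard's lemma -/

section Radial

variable {E : Type} [NormedAddCommGroup E] [InnerProductSpace ℝ E] {F : Type*}

/-- The value of `f` at a vector depends only on the norm of the vector. -/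
def IsRadial (f : E → F) : Prop := ∀ x y, ‖x‖ = ‖y‖ → f x = f y

variable {f : E → ℝ}

local notation "⟪" x ", " y "⟫" => inner ℝ x y

/-- The points `y + s w` and `y - s w` have equal norm, so the derivative along `w` equals its own
negative. -/
lemma IsRadial.fderiv_eq_zero_of_inner_eq_zero (hr : IsRadial f) (hf : ContDiff ℝ ∞ f) {y w : E}
    (h : ⟪y, w⟫ = 0) : fderiv ℝ f y w = 0 := by
  have hd (u : E) : HasDerivAt (fun s : ℝ => f (y + s • u)) (fderiv ℝ f y u) 0 := by
    have h1 : HasDerivAt (fun t : ℝ => y + t • u) u 0 := by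
      simpa using ((hasDerivAt_id (0 : ℝ)).smul_const u).const_add y
    have h2 : HasFDerivAt f (fderiv ℝ f y) (y + (0 : ℝ) • u) := by
      simpa using (hf.differentiable (by simp) y).hasFDerivAt
    exact h2.comp_hasDerivAt _ h1
  have he : (fun s : ℝ => f (y + s • w)) = fun s : ℝ => f (y + s • (-w)) := by
    funext s
    apply hr
    rw [← sq_eq_sq₀ (norm_nonneg _) (norm_nonneg _), norm_add_sq_real, norm_add_sq_real]
    simp [inner_smul_right, h, norm_smul]
  have := (hd w).unique (he ▸ hd (-w))
  rw [map_neg] at this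
  linarith

lemma IsRadial.fderiv_mul_norm_sq (hr : IsRadial f) (hf : ContDiff ℝ ∞ f) (y v : E) :
    fderiv ℝ f y v * ‖y‖ ^ 2 = ⟪v, y⟫ * fderiv ℝ f y y := by
  -- This `w` is `‖y‖²` times the component of `v` orthogonal to `y`, which avoids dividing by
  -- `‖y‖²`.
  have := hr.fderiv_eq_zero_of_inner_eq_zero hf (y := y) (w := (‖y‖ ^ 2) • v - ⟪v, y⟫ • y) (by
    rw [inner_sub_right, inner_smul_right, inner_smul_right, real_inner_self_eq_norm_sq,
      real_inner_comm]
    ring)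
  rw [map_sub, map_smul, map_smul, smul_eq_mul, smul_eq_mul] at this
  linarith

/-- The derivative along `v` vanishes on the hyperplane `vᗮ`; integrating its own derivative from
the projection of `x` to `x` extracts the factor `⟪v, x⟫`. -/
lemma IsRadial.exists_fderiv_eq_inner_mul [FiniteDimensional ℝ E] (hr : IsRadial f)
    (hf : ContDiff ℝ ∞ f) {v : E} (hv : ‖v‖ = 1) :
    ∃ a : E → ℝ, ContDiff ℝ ∞ a ∧ ∀ x, fderiv ℝ f x v = ⟪v, x⟫ * a x := by
  have hb : ContDiff ℝ ∞ fun x => fderiv ℝ f x v :=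
    (hf.fderiv_right (m := ∞) (by simp)).clm_apply contDiff_const
  have hb' : ContDiff ℝ ∞ (fderiv ℝ fun x => fderiv ℝ f x v) :=
    hb.fderiv_right (m := ∞) (by simp)
  have hi : ContDiff ℝ ∞ fun x : E => ⟪v, x⟫ := contDiff_const.inner ℝ contDiff_id
  refine ⟨fun x => ∫ t in (0 : ℝ)..1,
    fderiv ℝ (fun x => fderiv ℝ f x v) (x - ⟪v, x⟫ • v + t • ⟪v, x⟫ • v) v, ?_, fun x => ?_⟩
  · apply contDiff_parametric_intervalIntegral
    refine (hb'.comp ?_).clm_apply contDiff_const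
    have h1 : ContDiff ℝ ∞ fun p : E × ℝ => ⟪v, p.1⟫ := hi.comp contDiff_fst
    exact (contDiff_fst.sub (h1.smul contDiff_const)).add
      (contDiff_snd.smul (h1.smul contDiff_const))
  · have h0 := hb.add_sub_eq_integral_fderiv (x - ⟪v, x⟫ • v) (⟪v, x⟫ • v)
    rw [hr.fderiv_eq_zero_of_inner_eq_zero hf (y := x - ⟪v, x⟫ • v) (w := v) (by
      rw [inner_sub_left, inner_smul_left, real_inner_self_eq_norm_sq, hv, real_inner_comm]
      simp), sub_add_cancel, sub_zero] at h0
    rw [h0, ← intervalIntegral.integral_const_mul]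
    simp only [map_smul, smul_eq_mul]

lemma IsRadial.exists_fderiv_self_eq [FiniteDimensional ℝ E] [Nontrivial E] (hr : IsRadial f)
    (hf : ContDiff ℝ ∞ f) :
    ∃ a : E → ℝ, ContDiff ℝ ∞ a ∧ ∀ x, fderiv ℝ f x x = ‖x‖ ^ 2 * a x := by
  obtain ⟨v, hv⟩ := exists_norm_eq E zero_le_one
  obtain ⟨a, ha, hav⟩ := hr.exists_fderiv_eq_inner_mul hf hv
  refine ⟨a, ha, fun x => ?_⟩
  have key (y : E) (hy : ⟪v, y⟫ ≠ 0) : fderiv ℝ f y y = ‖y‖ ^ 2 * a y := by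
    have := hr.fderiv_mul_norm_sq hf y v
    rw [hav] at this
    apply mul_left_cancel₀ hy
    linarith
  -- On the hyperplane nothing can be cancelled; there the identity follows by continuity along `x +
  -- s v`, where the inner product with `v` is `s`.
  by_cases hx : ⟪v, x⟫ = 0
  · have hc := hf.continuous_fderiv (by simp)
    have hac := ha.continuous
    have : (fun s : ℝ => fderiv ℝ f (x + s • v) (x + s • v)) =
        fun s : ℝ => ‖x + s • v‖ ^ 2 * a (x + s • v) := by
      refine Continuous.ext_on (dense_compl_singleton (0 : ℝ)) (by fun_prop) (by fun_prop) ?_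
      intro s hs
      apply key
      rw [inner_add_right, inner_smul_right, hx, real_inner_self_eq_norm_sq, hv]
      simpa using hs
    simpa using congrFun this 0
  · exact key x hx

/-- Hadamard's lemma for radial functions. -/
lemma IsRadial.exists_eq_add_norm_sq_mul [FiniteDimensional ℝ E] [Nontrivial E] (hr : IsRadial f)
    (hf : ContDiff ℝ ∞ f) :
    ∃ h : E → ℝ, ContDiff ℝ ∞ h ∧ IsRadial h ∧ ∀ x, f x = f 0 + ‖x‖ ^ 2 * h x := by
  obtain ⟨a, ha, hfa⟩ := hr.exists_fderiv_self_eq hf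
  have key (x : E) : f x = f 0 + ‖x‖ ^ 2 * ∫ t in (0 : ℝ)..1, t * a (t • x) := by
    have h0 := hf.add_sub_eq_integral_fderiv 0 x
    rw [zero_add] at h0
    rw [← intervalIntegral.integral_const_mul, ← sub_eq_iff_eq_add', h0]
    refine intervalIntegral.integral_congr_ae (Eventually.of_forall fun t ht => ?_)
    -- `hfa` at `t • x` carries a spare factor `t` on both sides; the half-open interval excludes
    -- `0`, so it cancels.
    have ht0 : t ≠ 0 := by
      rw [Set.uIoc_of_le zero_le_one] at ht
      exact ht.1.ne'
    have := hfa (t • x)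
    rw [map_smul, norm_smul, smul_eq_mul, mul_pow, Real.norm_eq_abs, sq_abs] at this
    rw [zero_add]
    apply mul_left_cancel₀ ht0
    linarith
  refine ⟨fun x => ∫ t in (0 : ℝ)..1, t * a (t • x), ?_, fun x y hxy => ?_, key⟩
  · apply contDiff_parametric_intervalIntegral
    exact contDiff_snd.mul (ha.comp (contDiff_snd.smul contDiff_fst))
  -- Away from `0` radiality of the quotient is inherited from `f` by cancelling `‖x‖²`.
  · by_cases hx : x = 0
    · have hy : y = 0 := by simpa [hx, eq_comm] using hxy
      rw [hx, hy]
    · have h1 := key x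
      rw [hr x y hxy, key y, ← hxy, add_right_inj] at h1
      exact (mul_left_cancel₀ (by simpa using hx) h1).symm

/-- A radial smooth map into a given ball that is the identity near the origin. -/
lemma exists_radial_retract (E : Type) [NormedAddCommGroup E] [InnerProductSpace ℝ E] {ε : ℝ}
    (hε : 0 < ε) :
    ∃ c : E → ℝ, ContDiff ℝ ∞ c ∧ IsRadial c ∧ (∀ x, ‖c x • x‖ < ε) ∧ ∀ᶠ x in 𝓝 0, c x = 1 := by
  -- The argument is at least `1` when `‖x‖² ≤ ε²/2` and at most `0` when `‖x‖ ≥ ε`.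
  refine ⟨fun x => Real.smoothTransition (2 - 2 * (‖x‖ ^ 2 / ε ^ 2)), ?_, fun x y hxy => ?_,
    fun x => ?_, ?_⟩
  · exact Real.smoothTransition.contDiff.comp
      (contDiff_const.sub (contDiff_const.mul ((contDiff_norm_sq ℝ).div_const _)))
  · simp only [hxy]
  · rcases lt_or_ge ‖x‖ ε with h | h
    · rw [norm_smul, Real.norm_of_nonneg (Real.smoothTransition.nonneg _)]
      exact lt_of_le_of_lt
        (mul_le_of_le_one_left (norm_nonneg _) (Real.smoothTransition.le_one _)) h
    · have : 1 ≤ ‖x‖ ^ 2 / ε ^ 2 := by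
        rw [one_le_div (by positivity)]
        gcongr
      simpa [Real.smoothTransition.zero_of_nonpos (by linarith : 2 - 2 * (‖x‖ ^ 2 / ε ^ 2) ≤ 0)]
        using hε
  · have hc : Continuous fun x : E => ‖x‖ ^ 2 / ε ^ 2 := by fun_prop
    filter_upwards [(hc.tendsto 0).eventually_lt_const (u := 1 / 2) (by simp)] with x hx
    exact Real.smoothTransition.one_of_one_le (by linarith)

/-- A smooth map into a space of smaller dimension whose squared norm is `‖x‖ ^ 2 * h x` near the
origin has a direction of vanishing derivative there, so `h 0 = 0`. -/
lemma eq_zero_of_norm_sq_eq_norm_sq_mul [FiniteDimensional ℝ E] {E' : Type}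
    [NormedAddCommGroup E'] [InnerProductSpace ℝ E'] [FiniteDimensional ℝ E']
    (hdim : Module.finrank ℝ E' < Module.finrank ℝ E) {q : E → E'} (hq : DifferentiableAt ℝ q 0)
    {h : E → ℝ} (hh : ContinuousAt h 0) (he : ∀ᶠ x in 𝓝 0, ‖q x‖ ^ 2 = ‖x‖ ^ 2 * h x) :
    h 0 = 0 := by
  have hq0 : q 0 = 0 := by simpa using he.self_of_nhds
  have hker := LinearMap.ker_ne_bot_of_finrank_lt (f := (fderiv ℝ q 0).toLinearMap) hdim
  obtain ⟨v, hv, hv0⟩ := Submodule.exists_mem_ne_zero_of_ne_bot hker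
  have hl : Tendsto (fun t : ℝ => t • v) (𝓝[≠] 0) (𝓝 0) := by
    have : Continuous fun t : ℝ => t • v := by fun_prop
    simpa using (this.tendsto 0).mono_left nhdsWithin_le_nhds
  have h1 : HasDerivAt (fun t : ℝ => q (t • v)) 0 0 := by
    have h2 : HasDerivAt (fun t : ℝ => t • v) v 0 := by
      simpa using (hasDerivAt_id (0 : ℝ)).smul_const v
    have h3 : HasFDerivAt q (fderiv ℝ q 0) ((0 : ℝ) • v) := by
      simpa using hq.hasFDerivAt
    have h4 := h3.comp_hasDerivAt _ h2
    have h5 : fderiv ℝ q 0 v = 0 := hv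
    rwa [h5] at h4
  have h2 : Tendsto (fun t : ℝ => ‖t⁻¹ • q (t • v)‖ ^ 2) (𝓝[≠] 0) (𝓝 0) := by
    have := (hasDerivAt_iff_tendsto_slope_zero.1 h1).norm.pow 2
    simpa [hq0] using this
  have h3 : Tendsto (fun t : ℝ => ‖v‖ ^ 2 * h (t • v)) (𝓝[≠] 0) (𝓝 (‖v‖ ^ 2 * h 0)) :=
    (hh.tendsto.comp hl).const_mul _
  have h4 := tendsto_nhds_unique (h3.congr' ?_) h2
  · simpa [hv0] using h4
  · filter_upwards [hl.eventually he, self_mem_nhdsWithin] with t ht ht0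
    have ht0 : t ≠ 0 := ht0
    rw [norm_smul, mul_pow, ht, norm_smul, mul_pow]
    simp only [norm_inv, Real.norm_eq_abs, inv_pow, sq_abs]
    field_simp

end Radial

/-- An augmented algebra whose augmentation ideal is generated by `s` has a point derivation with
value `1` at `s`, provided that the annihilator of `s` lies in the augmentation ideal. -/
lemma exists_derivation_of_principal {A : Type*} [CommRing A] [Algebra ℝ A] (ε : A →ₐ[ℝ] ℝ) {s : A}
    (hs : ε s = 0) (hdiv : ∀ a, ∃ b, a = algebraMap ℝ A (ε a) + s * b)
    (hann : ∀ b, s * b = 0 → ε b = 0) :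
    ∃ D : A →ₗ[ℝ] ℝ, (∀ a a', D (a * a') = ε a * D a' + ε a' * D a) ∧ D s = 1 := by
  choose b hb using hdiv
  -- By `hann` the value `ε (b a)` does not depend on the chosen cofactor, so linearity and the
  -- Leibniz rule reduce to exhibiting a cofactor.
  have key (a b' : A) (c : ℝ) (h : a = algebraMap ℝ A c + s * b') : ε (b a) = ε b' := by
    have hc : ε a = c := by simpa [hs] using congrArg ε h
    have h' := (hb a).symm.trans h
    rw [hc, add_right_inj, ← sub_eq_zero, ← mul_sub] at h'
    simpa [sub_eq_zero] using hann _ h'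
  refine ⟨
    { toFun := fun a => ε (b a)
      map_add' := fun a a' => ?_
      map_smul' := fun c a => ?_ }, fun a a' => ?_, ?_⟩
  · rw [← map_add]
    apply key _ _ (ε a + ε a')
    rw [map_add]
    linear_combination hb a + hb a'
  · rw [RingHom.id_apply, ← map_smul]
    apply key _ _ (c * ε a)
    rw [map_mul, Algebra.smul_def, Algebra.smul_def]
    linear_combination algebraMap ℝ A c * hb a
  · change ε (b (a * a')) = ε a * ε (b a') + ε a' * ε (b a)
    rw [key (a * a') (algebraMap ℝ A (ε a) * b a' + algebraMap ℝ A (ε a') * b a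
      + s * (b a * b a')) (ε a * ε a')]
    · simp [hs]
    · rw [map_mul]
      linear_combination a' * hb a + (algebraMap ℝ A (ε a) + s * b a) * hb a'
  · change ε (b s) = 1
    rw [key s 1 0 (by simp), map_one]

namespace DiffTangent

/-! ### Germs at the origin of the orbit space -/

section RadialGerm

variable {k : ℕ}

/-- The projection of Euclidean space onto the orbit space. -/
abbrev OrbitSpace.mk (v : EuclideanSpace ℝ (Fin k)) : OrbitSpace k :=
  Quotient.mk (orthogonalSetoid k) v

lemma OrbitSpace.isPlot_mk : IsPlot (OrbitSpace.mk (k := k)) :=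
  fun _ => ⟨id, isPlot_id, Eventually.of_forall fun _ => rfl⟩

/-- The reflection in the hyperplane orthogonal to `v - w` exchanges `v` and `w`. -/
lemma orthogonalSetoid_of_norm_eq {v w : EuclideanSpace ℝ (Fin k)} (h : ‖v‖ = ‖w‖) :
    OrbitSpace.mk v = OrbitSpace.mk w :=
  Quotient.sound ⟨Submodule.reflection (ℝ ∙ (v - w))ᗮ, Submodule.reflection_sub h⟩

/-- The function on the orbit space induced by a radial function. -/
def radialLift {F : Type*} {f : EuclideanSpace ℝ (Fin k) → F} (hr : IsRadial f) :
    OrbitSpace k → F :=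
  Quotient.lift f fun v w ⟨A, h⟩ => hr v w (by rw [← h, A.norm_map])

lemma isRadial_comp_mk {F : Type*} (φ : OrbitSpace k → F) : IsRadial fun v => φ (OrbitSpace.mk v) :=
  fun _ _ h => congrArg φ (orthogonalSetoid_of_norm_eq h)

lemma smoothNear_radialLift {f : EuclideanSpace ℝ (Fin k) → ℝ} (hr : IsRadial f)
    (hf : ContDiff ℝ ∞ f) (z : OrbitSpace k) : SmoothNear (radialLift hr) z := by
  refine ⟨Set.univ, @isOpen_univ _ dTopology, Set.mem_univ z, fun n p hp _ => ?_⟩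
  refine ContDiff.isPlot (contDiff_iff_contDiffAt.2 fun t => ?_)
  obtain ⟨q, hq, hpq⟩ := hp t
  refine (hf.comp hq.contDiff).contDiffAt.congr_of_eventuallyEq ?_
  filter_upwards [hpq] with r hr'
  rw [Function.comp_apply, hr']
  rfl

/-- Plots lift locally to `ℝᵏ`, so the image of each ball about `0` is D-open. This turns equality
of germs into a statement on `ℝᵏ`. -/
lemma eventually_dNhds_origin {P : OrbitSpace k → Prop} :
    (∀ᶠ z in dNhds (origin k), P z) ↔
      ∀ᶠ x : EuclideanSpace ℝ (Fin k) in 𝓝 0, P (OrbitSpace.mk x) := by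
  constructor
  · intro h
    exact (@Continuous.tendsto _ _ _ dTopology _ OrbitSpace.isPlot_mk.continuous 0).eventually h
  · intro h
    obtain ⟨ε, hε, hb⟩ := Metric.eventually_nhds_iff_ball.1 h
    have hn : IsRadial fun x : EuclideanSpace ℝ (Fin k) => ‖x‖ := fun _ _ => id
    refine (@mem_nhds_iff _ dTopology _ _).2 ⟨{z | radialLift hn z < ε}, ?_, ?_, ?_⟩
    · rintro ⟨x⟩ hx
      exact hb x (mem_ball_zero_iff.2 hx)
    · refine isOpen_iff_preimages_plots.2 fun n p hp => isOpen_iff_mem_nhds.2 fun t ht => ?_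
      obtain ⟨q, hq, hpq⟩ := hp t
      have ht' : ‖q t‖ < ε := by
        have : radialLift hn (p t) < ε := ht
        rwa [hpq.self_of_nhds] at this
      filter_upwards [hpq, hq.contDiff.continuous.norm.continuousAt.eventually_lt_const ht']
        with r h1 h2
      change radialLift hn (p r) < ε
      rw [h1]
      exact h2
    · change ‖(0 : EuclideanSpace ℝ (Fin k))‖ < ε
      simpa using hε

/-- The germ at the origin of the orbit space of a smooth radial function. -/
def radialGerm {f : EuclideanSpace ℝ (Fin k) → ℝ} (hr : IsRadial f) (hf : ContDiff ℝ ∞ f) :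
    SmoothGerm (origin k) :=
  Ideal.Quotient.mk _ ⟨radialLift hr, smoothNear_radialLift hr hf _⟩

lemma evalGerm_radialGerm {f : EuclideanSpace ℝ (Fin k) → ℝ} (hr : IsRadial f)
    (hf : ContDiff ℝ ∞ f) : evalGerm (origin k) (radialGerm hr hf) = f 0 :=
  rfl

lemma germ_eq_iff {φ ψ : smoothNearAlg (origin k)} :
    (Ideal.Quotient.mk (nearZeroIdeal (origin k)) φ = Ideal.Quotient.mk _ ψ) ↔
      ∀ᶠ x : EuclideanSpace ℝ (Fin k) in 𝓝 0, φ.1 (OrbitSpace.mk x) = ψ.1 (OrbitSpace.mk x) := by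
  rw [Ideal.Quotient.eq, ← eventually_dNhds_origin (P := fun z => φ.1 z = ψ.1 z)]
  simp only [← sub_eq_zero (a := φ.1 _)]
  rfl

/-- Composing with the radial retraction makes a locally smooth representative globally smooth
without losing radiality. -/
lemma exists_eq_radialGerm (a : SmoothGerm (origin k)) :
    ∃ (f : EuclideanSpace ℝ (Fin k) → ℝ) (hr : IsRadial f) (hf : ContDiff ℝ ∞ f),
      a = radialGerm hr hf := by
  obtain ⟨φ, rfl⟩ := Ideal.Quotient.mk_surjective a
  obtain ⟨u, hu, h0, hφ⟩ := φ.2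
  have hv : IsOpen (OrbitSpace.mk ⁻¹' u) :=
    isOpen_iff_preimages_plots.1 hu k _ OrbitSpace.isPlot_mk
  obtain ⟨ε, hε, hb⟩ := Metric.isOpen_iff.1 hv 0 h0
  obtain ⟨c, hc, hcr, hcε, hc1⟩ := exists_radial_retract (EuclideanSpace ℝ (Fin k)) hε
  have hp : IsPlot fun x : EuclideanSpace ℝ (Fin k) => OrbitSpace.mk (c x • x) :=
    isPlot_reparam OrbitSpace.isPlot_mk (hc.smul contDiff_id)
  refine ⟨fun x => φ.1 (OrbitSpace.mk (c x • x)), fun x y hxy => ?_,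
    (hφ k _ hp fun x => hb (mem_ball_zero_iff.2 (hcε x))).contDiff, ?_⟩
  · exact isRadial_comp_mk φ.1 _ _ (by rw [norm_smul, norm_smul, hxy, hcr x y hxy])
  · refine germ_eq_iff.2 ?_
    filter_upwards [hc1] with x hx
    change φ.1 (OrbitSpace.mk x) = φ.1 (OrbitSpace.mk (c x • x))
    rw [hx, one_smul]

lemma isRadial_norm_sq : IsRadial fun x : EuclideanSpace ℝ (Fin k) => ‖x‖ ^ 2 :=
  fun _ _ h => congrArg (· ^ 2) h

variable (k) in
/-- The germ of the squared norm. -/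
def normSqGerm : SmoothGerm (origin k) :=
  radialGerm isRadial_norm_sq (contDiff_norm_sq ℝ)

lemma evalGerm_normSqGerm : evalGerm (origin k) (normSqGerm k) = 0 := by
  simp [normSqGerm, evalGerm_radialGerm]

lemma exists_eq_algebraMap_add_normSqGerm_mul [NeZero k] (a : SmoothGerm (origin k)) :
    ∃ b, a = algebraMap ℝ (SmoothGerm (origin k)) (evalGerm (origin k) a) + normSqGerm k * b := by
  obtain ⟨f, hr, hf, rfl⟩ := exists_eq_radialGerm a
  obtain ⟨h, hh, hhr, hfh⟩ := hr.exists_eq_add_norm_sq_mul hf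
  refine ⟨radialGerm hhr hh, ?_⟩
  refine germ_eq_iff.2 (Eventually.of_forall fun x => ?_)
  exact hfh x

/-- Near the origin the second factor vanishes off `0`, hence also at `0` by continuity, as `0` is
not isolated. -/
lemma evalGerm_eq_zero_of_normSqGerm_mul_eq_zero [NeZero k] {b : SmoothGerm (origin k)}
    (hb : normSqGerm k * b = 0) : evalGerm (origin k) b = 0 := by
  obtain ⟨h, hr, hh, rfl⟩ := exists_eq_radialGerm b
  have h0 : ∀ᶠ x : EuclideanSpace ℝ (Fin k) in 𝓝 0, ‖x‖ ^ 2 * h x = 0 :=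
    germ_eq_iff (ψ := 0).1 hb
  have h1 : ∀ᶠ x : EuclideanSpace ℝ (Fin k) in 𝓝[≠] 0, h x = 0 := by
    filter_upwards [h0.filter_mono nhdsWithin_le_nhds, self_mem_nhdsWithin] with x hx hx0
    exact (mul_eq_zero.1 hx).resolve_left (by simpa using hx0)
  have h2 : Tendsto h (𝓝[≠] 0) (𝓝 (h 0)) :=
    (hh.continuous.tendsto 0).mono_left nhdsWithin_le_nhds
  exact tendsto_nhds_unique h2 (tendsto_const_nhds.congr' (h1.mono fun _ => Eq.symm))

end RadialGerm

/-! ### The right tangent space at the origin -/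

section Derivation

variable {k : ℕ}

lemma rightTangent_algebraMap {X : Type*} [DiffeologicalSpace X] {x : X} (D : RightTangent x)
    (c : ℝ) : D.1 (algebraMap ℝ _ c) = 0 := by
  have h := D.2 1 1
  simp only [mul_one, map_one, one_mul] at h
  rw [Algebra.algebraMap_eq_smul_one, map_smul, left_eq_add.1 h, smul_zero]

lemma rightTangent_apply (D : RightTangent (origin k)) (c : ℝ) (b : SmoothGerm (origin k)) :
    D.1 (algebraMap ℝ _ c + normSqGerm k * b) = evalGerm (origin k) b * D.1 (normSqGerm k) := by
  rw [map_add, rightTangent_algebraMap, D.2, evalGerm_normSqGerm]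
  ring

variable (k) in
/-- Evaluation of a derivation on the squared norm. -/
def evalNormSq : RightTangent (origin k) →ₗ[ℝ] ℝ where
  toFun D := D.1 (normSqGerm k)
  map_add' _ _ := rfl
  map_smul' _ _ := rfl

lemma evalNormSq_injective [NeZero k] : Function.Injective (evalNormSq k) := by
  refine (injective_iff_map_eq_zero _).2 fun D hD => Subtype.ext (LinearMap.ext fun a => ?_)
  have hD : D.1 (normSqGerm k) = 0 := hD
  obtain ⟨b, hb⟩ := exists_eq_algebraMap_add_normSqGerm_mul a
  rw [hb, rightTangent_apply, hD, mul_zero]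
  rfl

variable (k) in
/-- There is a derivation that takes the value `1` on the squared norm. -/
lemma exists_evalNormSq_eq_one [NeZero k] : ∃ D, evalNormSq k D = 1 := by
  obtain ⟨D, hD, h1⟩ := exists_derivation_of_principal (A := SmoothGerm (origin k))
    (evalGerm (origin k)) (evalGerm_normSqGerm (k := k))
    (exists_eq_algebraMap_add_normSqGerm_mul (k := k))
    fun _ => evalGerm_eq_zero_of_normSqGerm_mul_eq_zero (k := k)
  exact ⟨⟨D, hD⟩, h1⟩

end Derivation

/-! ### Morphisms between orbit spaces -/

section Morphisms

variable {m n : ℕ}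

lemma exists_linearIsometry_of_le (h : m ≤ n) :
    Nonempty (EuclideanSpace ℝ (Fin m) →ₗᵢ[ℝ] EuclideanSpace ℝ (Fin n)) := by
  let v := (EuclideanSpace.basisFun (Fin m) ℝ)
  let w := (EuclideanSpace.basisFun (Fin n) ℝ)
  let f := v.toBasis.constr ℝ (w ∘ Fin.castLE h)
  refine ⟨f.isometryOfOrthonormal (v := v.toBasis) (by simp) ?_⟩
  have : f ∘ v.toBasis = w ∘ Fin.castLE h := funext fun i => Module.Basis.constr_basis _ _ _ _
  rw [this]
  exact w.orthonormal.comp _ (Fin.castLE_injective h)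

/-- The map of orbit spaces induced by a linear isometry. -/
def orbitMap (i : EuclideanSpace ℝ (Fin m) →ₗᵢ[ℝ] EuclideanSpace ℝ (Fin n)) :
    LocalMap (origin m) (origin n) := by
  refine ⟨Quotient.lift (fun v => OrbitSpace.mk (i v)) fun v w ⟨A, h⟩ =>
    orthogonalSetoid_of_norm_eq (by rw [i.norm_map, i.norm_map, ← h, A.norm_map]), ?_, ?_⟩
  · refine ⟨Set.univ, @isOpen_univ _ dTopology, Set.mem_univ _, fun d p hp _ t => ?_⟩
    obtain ⟨q, hq, hpq⟩ := hp t
    refine ⟨i ∘ q, (i.toContinuousLinearMap.contDiff.comp hq.contDiff).isPlot, ?_⟩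
    filter_upwards [hpq] with r hr
    rw [Function.comp_apply, hr]
    rfl
  · exact congrArg OrbitSpace.mk (map_zero i)

lemma pullback_orbitMap_normSqGerm
    (i : EuclideanSpace ℝ (Fin m) →ₗᵢ[ℝ] EuclideanSpace ℝ (Fin n)) :
    (orbitMap i).pullback (normSqGerm n) = normSqGerm m := by
  refine germ_eq_iff.2 (Eventually.of_forall fun x => ?_)
  exact congrArg (· ^ 2) (i.norm_map x)

/-- Near the origin a local map between orbit spaces lifts to a smooth map of Euclidean spaces. -/
lemma LocalMap.exists_contDiff_lift (f : LocalMap (origin m) (origin n)) :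
    ∃ q : EuclideanSpace ℝ (Fin m) → EuclideanSpace ℝ (Fin n), ContDiff ℝ ∞ q ∧
      ∀ᶠ x in 𝓝 0, f.1 (OrbitSpace.mk x) = OrbitSpace.mk (q x) := by
  obtain ⟨u, hu, h0, hf⟩ := f.2.1
  have hv : IsOpen (OrbitSpace.mk ⁻¹' u) :=
    isOpen_iff_preimages_plots.1 hu m _ OrbitSpace.isPlot_mk
  -- The retraction turns the projection into a plot with values in `u`; its image under `f` is a
  -- plot of the quotient and so lifts near `0`.
  obtain ⟨g, hg, hgu, hg0⟩ := exists_smooth_retract hv (t := 0) h0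
  obtain ⟨q, hq, hfq⟩ := hf m _ (isPlot_reparam OrbitSpace.isPlot_mk hg) hgu 0
  refine ⟨q, hq.contDiff, ?_⟩
  filter_upwards [hfq, hg0] with x h1 h2
  exact (congrArg (fun z => f.1 (OrbitSpace.mk z)) h2.symm).trans h1

/-- The pulled-back germ is `normSqGerm m * b`, on which `D` is `b(0)` times its value on
`normSqGerm m`; the drop in dimension forces `b(0) = 0`. -/
lemma LocalMap.rightTangent_pullback_normSqGerm_eq_zero (h : n < m)
    (f : LocalMap (origin m) (origin n)) (D : RightTangent (origin m)) :
    D.1 (f.pullback (normSqGerm n)) = 0 := by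
  have : NeZero m := ⟨by omega⟩
  obtain ⟨b, hb⟩ := exists_eq_algebraMap_add_normSqGerm_mul (f.pullback (normSqGerm n))
  rw [hb, rightTangent_apply]
  have h0 : evalGerm (origin m) (f.pullback (normSqGerm n)) = 0 :=
    (GermHom.evalGerm_pullback (Quotient.mk _ f) _).trans evalGerm_normSqGerm
  rw [h0, map_zero, zero_add] at hb
  obtain ⟨g, hr, hg, rfl⟩ := exists_eq_radialGerm b
  obtain ⟨q, hq, hfq⟩ := f.exists_contDiff_lift
  have hn := germ_eq_iff.1 hb
  rw [evalGerm_radialGerm, eq_zero_of_norm_sq_eq_norm_sq_mul (by simpa using h)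
    (hq.differentiable (by simp) 0) hg.continuous.continuousAt, zero_mul]
  filter_upwards [hn, hfq] with x h1 h2
  change radialLift isRadial_norm_sq (f.1 (OrbitSpace.mk x)) = ‖x‖ ^ 2 * g x at h1
  rw [h2] at h1
  exact h1

end Morphisms

end DiffTangent

end

theorem theorem2 (n m : ℕ) (hn : 1 ≤ n) (hm : 1 ≤ m) :
    (m ≤ n → Nonempty (DiffTangent.TestRightTangent (DiffTangent.origin m)
        (DiffTangent.origin n) ≃ₗ[ℝ] ℝ)) ∧
    (n < m → DiffTangent.TestRightTangent (DiffTangent.origin m) (DiffTangent.origin n) = ⊥) := by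
  have : NeZero n := ⟨by omega⟩
  have : NeZero m := ⟨by omega⟩
  refine ⟨fun h => ?_, fun h => ?_⟩
  · obtain ⟨i⟩ := DiffTangent.exists_linearIsometry_of_le h
    obtain ⟨D, hD⟩ := DiffTangent.exists_evalNormSq_eq_one m
    let f : DiffTangent.GermHom (DiffTangent.origin m) (DiffTangent.origin n) :=
      Quotient.mk _ (DiffTangent.orbitMap i)
    have hE : DiffTangent.evalNormSq n (f.rightMap D) = 1 :=
      (congrArg D.1 (DiffTangent.pullback_orbitMap_normSqGerm i)).trans hD
    refine ⟨LinearEquiv.ofBijective ((DiffTangent.evalNormSq n).domRestrict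
      (DiffTangent.TestRightTangent (DiffTangent.origin m) (DiffTangent.origin n))) ⟨?_, ?_⟩⟩
    · exact DiffTangent.evalNormSq_injective.comp Subtype.val_injective
    · intro c
      refine ⟨c • ⟨f.rightMap D, Submodule.subset_span ⟨f, D, rfl⟩⟩, ?_⟩
      rw [map_smul, LinearMap.domRestrict_apply, hE, smul_eq_mul, mul_one]
  · refine Submodule.span_eq_bot.2 ?_
    rintro _ ⟨f, D, rfl⟩
    obtain ⟨f, rfl⟩ := Quotient.exists_rep f
    -- It suffices to test the generating vectors on the squared norm.
    apply DiffTangent.evalNormSq_injective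
    rw [map_zero]
    exact f.rightTangent_pullback_normSqGerm_eq_zero h D
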